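/- Theorem 7. Let $k\ge 2$ be an integer. There are a constant $C_k>0$ and a function $\delta_k:\mathbb{N}\to\mathbb{R}$ with $\delta_k(q)\to 0$ as $q\to\infty$, both depending only on $k$, such that the following holds. For every integer $q\ge 3$ and every real $x$ with $$\exp\Bigl(\frac{\log q}{\log\log q}\Bigr)\le x<q^{1/k},$$ there exists a non-principal Dirichlet character $\chi \pmod q$ for which $$\frac{1}{\sqrt{x}}\,\Bigl|\sum_{1\le n\le x}\chi(n)\Bigr|\ \ge\ C_k\,(\log q)^{\frac{(k-1)^2}{2k}+\delta_k(q)} .$$ -/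

import Mathlib

open Filter Topology

/-! Write `L = log q`. By orthogonality, the `2k`-th moment of the character sums over all
characters mod `q` is at least `φ(q)` times the number of solutions of `n₁⋯n_k = n'₁⋯n'_k` in
integers up to `x` coprime to `q` (`totient_mul_card_equalProducts_le`). The principal character
contributes at most `x^(2k) ≤ x^k q`, so it is enough to produce `x^k L^((k-1)^2 - o(1))` solutions:
some non-principal sum then has `2k`-th power of that size.

Solutions come from `k × k` matrices of pairwise coprime integers coprime to `q`. The row products
and the column products solve the equation, and the gcd of a row product and a column product
recovers the entry, so distinct matrices give distinct solutions. Put each entry in a window `(T^e,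
T^(e+1)]` with `T ≈ L^η`, where the exponents `e` have constant row and column sums. This leaves
`(k-1)^2` free exponents with at least `L^(1-η)` choices each (`le_card_coprimeMatrices`). Each
choice contributes `x^k` matrices up to a factor `L^O(η)`, because `eventually_le_card_coprime`
shows that coprimality to a modulus `M` with `log M = O(L)` costs only `L^o(1)`, even for intervals
as short as `exp(c L / log L)`.

For each fixed `ε` this loses at most `L^ε` once `q` is large. The function `δ` comes from the
infimum of the admissible losses at each `q`, which is finite for every `q ≥ 3` by a crude
second-moment bound. -/

/-! ### Reciprocal sums over prime divisors -/

theorem tendsto_primeCounting_two_pow :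
    Tendsto (fun j : ℕ => (Nat.primeCounting (2 ^ (j + 1)) : ℝ) / 2 ^ j) atTop (𝓝 0) := by
  have h2 := Chebyshev.eventually_primeCounting_le (ε := 1) one_pos
  have ht : Tendsto (fun j : ℕ => (2 : ℝ) ^ (j + 1)) atTop atTop :=
    (tendsto_pow_atTop_atTop_of_one_lt one_lt_two).comp (tendsto_add_atTop_nat 1)
  have h3 := ht.eventually h2
  have h4 : Tendsto (fun j : ℕ => (2 * (Real.log 4 + 1) / Real.log 2) * (1 / ((j : ℝ) + 1)))
      atTop (𝓝 0) := by
    simpa using tendsto_one_div_add_atTop_nhds_zero_nat.const_mul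
      (2 * (Real.log 4 + 1) / Real.log 2)
  refine squeeze_zero' (Eventually.of_forall fun j => by positivity) ?_ h4
  filter_upwards [h3] with j hj
  have hf : ⌊(2 : ℝ) ^ (j + 1)⌋₊ = 2 ^ (j + 1) := by
    exact_mod_cast Nat.floor_natCast (R := ℝ) (2 ^ (j + 1))
  rw [hf, Real.log_pow] at hj
  have hl : 0 < Real.log 2 := Real.log_pos one_lt_two
  rw [div_le_iff₀ (by positivity)]
  refine hj.trans (le_of_eq ?_)
  push_cast
  field_simp
  ring

theorem sum_inv_primes_two_pow_le (J : ℕ) :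
    ∑ p ∈ (Finset.range (2 ^ J + 1)).filter Nat.Prime, (1 : ℝ) / p ≤
      ∑ j ∈ Finset.range J, (Nat.primeCounting (2 ^ (j + 1)) : ℝ) / 2 ^ j := by
  induction J with
  | zero =>
    have : (Finset.range (2 ^ 0 + 1)).filter Nat.Prime = ∅ := by decide
    rw [this]
    simp
  | succ J ih =>
    rw [Finset.sum_range_succ]
    have hsub : (Finset.range (2 ^ J + 1)).filter Nat.Prime ⊆
        (Finset.range (2 ^ (J + 1) + 1)).filter Nat.Prime := by
      refine Finset.filter_subset_filter _ (Finset.range_mono ?_)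
      have : 2 ^ J ≤ 2 ^ (J + 1) := Nat.pow_le_pow_right (by norm_num) (by omega)
      omega
    rw [← Finset.sum_sdiff hsub, add_comm]
    refine add_le_add ih ?_
    calc _ ≤ ∑ p ∈ (Finset.range (2 ^ (J + 1) + 1)).filter Nat.Prime \
          (Finset.range (2 ^ J + 1)).filter Nat.Prime, (1 : ℝ) / 2 ^ J := by
          refine Finset.sum_le_sum fun p hp => ?_
          simp only [Finset.mem_sdiff, Finset.mem_filter, Finset.mem_range, not_and'] at hp
          have h1 : 2 ^ J ≤ p := by
            have := hp.2 hp.1.2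
            omega
          have h2 : (2 : ℝ) ^ J ≤ p := by exact_mod_cast h1
          exact one_div_le_one_div_of_le (by positivity) h2
      _ ≤ _ := by
          rw [Finset.sum_const, nsmul_eq_mul, mul_one_div]
          gcongr
          rw [Nat.primeCounting, Nat.primeCounting', Nat.count_eq_card_filter_range]
          exact Finset.card_le_card Finset.sdiff_subset

theorem card_primeFactors_le_log (M : ℕ) (hM : 1 ≤ M) :
    (M.primeFactors.card : ℝ) * Real.log 2 ≤ Real.log M := by
  have h : 2 ^ M.primeFactors.card ≤ M := by
    calc 2 ^ M.primeFactors.card ≤ ∏ p ∈ M.primeFactors, p :=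
          by
          rw [← Finset.prod_const]
          exact Finset.prod_le_prod' fun p hp => (Nat.prime_of_mem_primeFactors hp).two_le
      _ ≤ M := Nat.le_of_dvd hM (Nat.prod_primeFactors_dvd M)
  have h' : ((2 : ℝ) ^ M.primeFactors.card) ≤ M := by exact_mod_cast h
  have := Real.log_le_log (by positivity) h'
  rwa [Real.log_pow] at this

/-- Primes above `L` contribute `O(1)`, since `M` has only `O(L)` prime factors. Smaller ones are
covered by about `log L / log 2` dyadic blocks, whose contributions tend to zero by Chebyshev, so
their Cesàro means do too. An `o(log L)` bound suffices because losses of `L^o(1)` are harmless. -/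
theorem eventually_sum_inv_primeFactors_le (K ε : ℝ) (hε : 0 < ε) :
    ∀ᶠ L : ℝ in atTop, ∀ M : ℕ, 1 ≤ M → Real.log M ≤ K * L →
      ∑ p ∈ M.primeFactors, (1 : ℝ) / p ≤ ε * Real.log L := by
  have hl2 : 0 < Real.log 2 := Real.log_pos one_lt_two
  have hces := (tendsto_primeCounting_two_pow).cesaro
  set η := ε * Real.log 2 / 4 with hη
  have hηp : 0 < η := by positivity
  have h1 : ∀ᶠ n : ℕ in atTop, ∑ j ∈ Finset.range n,
      (Nat.primeCounting (2 ^ (j + 1)) : ℝ) / 2 ^ j ≤ η * n := by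
    filter_upwards [hces.eventually (gt_mem_nhds hηp), eventually_gt_atTop 0] with n hn hn0
    have hn0' : (0 : ℝ) < n := by exact_mod_cast hn0
    rw [inv_mul_lt_iff₀ hn0'] at hn
    linarith
  have hlog : Tendsto (fun L : ℝ => Real.log L / Real.log 2) atTop atTop :=
    Real.tendsto_log_atTop.atTop_div_const hl2
  have hJ : Tendsto (fun L : ℝ => ⌊Real.log L / Real.log 2⌋₊ + 1) atTop atTop :=
    (tendsto_add_atTop_nat 1).comp (tendsto_nat_floor_atTop.comp hlog)
  filter_upwards [hJ.eventually h1, eventually_ge_atTop 2,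
    Real.tendsto_log_atTop.eventually_ge_atTop (2 * (K / Real.log 2) / ε)] with L hL hL2 hLK
  intro M hM hMK
  set J := ⌊Real.log L / Real.log 2⌋₊ + 1 with hJdef
  have hL0 : 0 < L := by linarith
  have hlogL : Real.log 2 ≤ Real.log L := Real.log_le_log (by norm_num) hL2
  have hJ1 : (J : ℝ) ≤ 2 * (Real.log L / Real.log 2) := by
    have ha : (1 : ℝ) ≤ Real.log L / Real.log 2 := by rwa [le_div_iff₀ hl2, one_mul]
    have := Nat.floor_le (a := Real.log L / Real.log 2) (by linarith)
    push_cast [hJdef]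
    linarith
  have hJ2 : L ≤ 2 ^ J := by
    have := Nat.lt_floor_add_one (Real.log L / Real.log 2)
    rw [div_lt_iff₀ hl2] at this
    rw [← Real.log_le_log_iff hL0 (by positivity), Real.log_pow]
    push_cast [hJdef]
    exact this.le
  have hsplit : ∑ p ∈ M.primeFactors, (1 : ℝ) / p ≤
      ∑ p ∈ (Finset.range (2 ^ J + 1)).filter Nat.Prime, (1 : ℝ) / p +
        ∑ p ∈ M.primeFactors, (1 : ℝ) / L := by
    rw [← Finset.sum_filter_add_sum_filter_not M.primeFactors (fun p => p < 2 ^ J + 1)]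
    refine add_le_add ?_ ?_
    · refine Finset.sum_le_sum_of_subset_of_nonneg ?_ (fun _ _ _ => by positivity)
      intro p hp
      simp only [Finset.mem_filter, Finset.mem_range] at hp ⊢
      exact ⟨hp.2, Nat.prime_of_mem_primeFactors hp.1⟩
    · refine (Finset.sum_le_sum (g := fun _ => 1 / L) fun p hp => ?_).trans
        (Finset.sum_le_sum_of_subset_of_nonneg (Finset.filter_subset _ _)
          (fun _ _ _ => by positivity))
      simp only [Finset.mem_filter, not_lt] at hp
      have h2 : (2 : ℝ) ^ J + 1 ≤ p := by exact_mod_cast hp.2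
      exact one_div_le_one_div_of_le hL0 (by linarith)
  have hcard : ∑ p ∈ M.primeFactors, (1 : ℝ) / L ≤ K / Real.log 2 := by
    rw [Finset.sum_const, nsmul_eq_mul, mul_one_div, div_le_div_iff₀ hL0 hl2]
    exact (card_primeFactors_le_log M hM).trans hMK
  have h3 : η * J ≤ ε / 2 * Real.log L := by
    calc η * J ≤ η * (2 * (Real.log L / Real.log 2)) := by gcongr
      _ = _ := by rw [hη]; field_simp; ring
  have h4 : K / Real.log 2 ≤ ε / 2 * Real.log L := by
    rw [div_le_iff₀ hε] at hLK
    linarith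
  have := sum_inv_primes_two_pow_le J
  linarith

/-! ### A sieve for integers coprime to a modulus -/

/-- The positive integers up to `y` that no element of `S` divides. -/
noncomputable def siftedSet (S : Finset ℕ) (y : ℝ) : Finset ℕ :=
  (Finset.Icc 1 ⌊y⌋₊).filter fun a => ∀ p ∈ S, ¬ p ∣ a

theorem card_siftedSet_insert {S : Finset ℕ} {p : ℕ} (hS : ∀ r ∈ S, r.Prime) (hp : p.Prime)
    (hpS : p ∉ S) (y : ℝ) :
    (siftedSet S y).card = (siftedSet (insert p S) y).card + (siftedSet S (y / p)).card := by
  have h1 : (siftedSet (insert p S) y) = (siftedSet S y).filter fun a => ¬ p ∣ a := by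
    ext a
    simp only [siftedSet, Finset.mem_filter, Finset.forall_mem_insert]
    tauto
  have h2 : (siftedSet S (y / p)).card = ((siftedSet S y).filter fun a => p ∣ a).card := by
    refine Finset.card_bij (fun b _ => p * b) ?_ ?_ ?_
    · intro b hb
      simp only [siftedSet, Finset.mem_filter, Finset.mem_Icc, Nat.floor_div_natCast] at hb ⊢
      refine ⟨⟨⟨Nat.mul_pos hp.pos hb.1.1, ?_⟩, ?_⟩, dvd_mul_right _ _⟩
      · rw [mul_comm]
        exact (Nat.le_div_iff_mul_le hp.pos).1 hb.1.2
      · intro r hr hd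
        rcases (hS r hr).dvd_mul.1 hd with h | h
        · rw [Nat.prime_dvd_prime_iff_eq (hS r hr) hp] at h
          exact hpS (h ▸ hr)
        · exact hb.2 r hr h
    · intro a _ b _ h
      exact Nat.eq_of_mul_eq_mul_left hp.pos h
    · intro a ha
      simp only [siftedSet, Finset.mem_filter, Finset.mem_Icc] at ha
      obtain ⟨⟨⟨ha1, ha2⟩, ha3⟩, b, rfl⟩ := ha
      refine ⟨b, ?_, rfl⟩
      simp only [siftedSet, Finset.mem_filter, Finset.mem_Icc, Nat.floor_div_natCast]
      refine ⟨⟨Nat.pos_of_ne_zero (by rintro rfl; simp at ha1), ?_⟩,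
        fun r hr hd => ha3 r hr (hd.mul_left p)⟩
      rw [Nat.le_div_iff_mul_le hp.pos, mul_comm]
      exact ha2
  rw [h1, h2, add_comm]
  exact (Finset.card_filter_add_card_filter_not _).symm

/-- Inserting `p` subtracts the count at `y / p`, so an error `√y * E` becomes at most `√y * E * (1
+ 1 / √p)`. Using `√y` instead of `1` for the rounding error of `⌊y⌋` keeps the product much smaller
than the `2^|S|` of the Legendre sieve. -/
theorem abs_card_siftedSet_sub_le {S : Finset ℕ} (hS : ∀ r ∈ S, r.Prime) :
    ∀ y : ℝ, 0 ≤ y → |((siftedSet S y).card : ℝ) - y * ∏ p ∈ S, (1 - 1 / (p : ℝ))| ≤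
      √y * ∏ p ∈ S, (1 + 1 / √(p : ℝ)) := by
  induction S using Finset.induction_on with
  | empty =>
    intro y hy
    have : ((siftedSet ∅ y).card : ℝ) = ⌊y⌋₊ := by simp [siftedSet]
    rw [this]
    simp only [Finset.prod_empty, mul_one]
    have h1 := Nat.floor_le hy
    have h2 := Nat.lt_floor_add_one y
    rw [abs_sub_comm, abs_of_nonneg (by linarith)]
    -- Arguments below `1` matter because the induction divides `y` by primes; there the error is `y
    -- ≤ √y`.
    rcases le_or_gt 1 y with h | h
    · have : 1 ≤ √y := Real.one_le_sqrt.2 h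
      linarith
    · have h3 : y ≤ √y := Real.le_sqrt_of_sq_le (by nlinarith)
      have : (0 : ℝ) ≤ ⌊y⌋₊ := by positivity
      linarith
  | insert p S hpS ih =>
    intro y hy
    have hp : p.Prime := hS p (Finset.mem_insert_self _ _)
    have hS' : ∀ r ∈ S, r.Prime := fun r hr => hS r (Finset.mem_insert_of_mem hr)
    have e := card_siftedSet_insert hS' hp hpS y
    have e' : ((siftedSet (insert p S) y).card : ℝ) =
        (siftedSet S y).card - (siftedSet S (y / p)).card := by
      rw [e]; push_cast; ring
    have i1 := ih hS' y hy
    have i2 := ih hS' (y / p) (by positivity)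
    rw [Finset.prod_insert hpS, Finset.prod_insert hpS, e']
    rw [Real.sqrt_div hy] at i2
    rw [abs_le] at *
    constructor
    · linear_combination i1.1 + i2.2
    · linear_combination i1.2 + i2.1

theorem siftedSet_primeFactors {M : ℕ} (hM : M ≠ 0) (y : ℝ) :
    siftedSet M.primeFactors y = (Finset.Icc 1 ⌊y⌋₊).filter fun a => a.Coprime M := by
  ext a
  simp only [siftedSet, Finset.mem_filter]
  refine and_congr_right fun _ => ?_
  constructor
  · intro h
    rw [Nat.coprime_iff_gcd_eq_one]
    by_contra hne
    obtain ⟨p, hp, hd⟩ := Nat.exists_prime_and_dvd hne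
    exact h p (Nat.mem_primeFactors.2 ⟨hp, hd.trans (Nat.gcd_dvd_right _ _), hM⟩)
      (hd.trans (Nat.gcd_dvd_left _ _))
  · intro h p hp hd
    exact (Nat.prime_of_mem_primeFactors hp).one_lt.ne'
      (Nat.dvd_one.1 (h ▸ Nat.dvd_gcd hd (Nat.dvd_of_mem_primeFactors hp)))

theorem exp_neg_two_mul_sum_le_prod {M : ℕ} :
    Real.exp (-2 * ∑ p ∈ M.primeFactors, (1 : ℝ) / p) ≤
      ∏ p ∈ M.primeFactors, (1 - 1 / (p : ℝ)) := by
  rw [Finset.mul_sum, Real.exp_sum]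
  refine Finset.prod_le_prod (fun _ _ => (Real.exp_pos _).le) fun p hp => ?_
  have h2 : (2 : ℝ) ≤ p := by exact_mod_cast (Nat.prime_of_mem_primeFactors hp).two_le
  set t := (1 : ℝ) / p with ht
  have ht0 : 0 ≤ t := by positivity
  have ht2 : t ≤ 1 / 2 := one_div_le_one_div_of_le (by norm_num) h2
  have h3 : 2 * t + 1 ≤ Real.exp (2 * t) := Real.add_one_le_exp _
  have h4 : Real.exp (-2 * t) * Real.exp (2 * t) = 1 := by
    rw [← Real.exp_add]; simp
  have h5 := Real.exp_pos (-2 * t)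
  have h6 : (2 * t + 1) * (1 - t) ≥ 1 := by nlinarith
  have h7 : Real.exp (-2 * t) * (2 * t + 1) ≤ 1 := by
    calc _ ≤ Real.exp (-2 * t) * Real.exp (2 * t) := by gcongr
      _ = 1 := h4
  nlinarith [mul_nonneg h5.le (sub_nonneg.2 h6)]

/-- By AM-GM, `1 / √p ≤ t + 1 / (p * t)`; the free parameter balances the number of prime factors
against their reciprocal sum. -/
theorem prod_one_add_inv_sqrt_le {M : ℕ} {t : ℝ} (ht : 0 < t) :
    ∏ p ∈ M.primeFactors, (1 + 1 / √(p : ℝ)) ≤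
      Real.exp (t * M.primeFactors.card + (∑ p ∈ M.primeFactors, (1 : ℝ) / p) / t) := by
  have : t * M.primeFactors.card + (∑ p ∈ M.primeFactors, (1 : ℝ) / p) / t =
      ∑ p ∈ M.primeFactors, (t + 1 / p / t) := by
    rw [Finset.sum_add_distrib, Finset.sum_const, Finset.sum_div, nsmul_eq_mul, mul_comm]
  rw [this, Real.exp_sum]
  refine Finset.prod_le_prod (fun _ _ => by positivity) fun p hp => ?_
  have hp0 : (0 : ℝ) < p := by exact_mod_cast (Nat.prime_of_mem_primeFactors hp).pos
  rw [add_comm]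
  refine le_trans (add_le_add_left ?_ 1) (Real.add_one_le_exp _)
  set u := 1 / √(p : ℝ) with hu
  have hu2 : 1 / (p : ℝ) = u * u := by
    rw [hu, div_mul_div_comm, Real.mul_self_sqrt hp0.le, one_mul]
  have hu0 : 0 ≤ u := by positivity
  rw [hu2, ← sub_nonneg]
  have : t + u * u / t - u = ((t - u / 2) ^ 2 + 3 / 4 * u ^ 2) / t := by
    field_simp; ring
  rw [this]
  positivity

theorem eventually_mul_sqrt_add_le (a b c : ℝ) (hc : 0 < c) :
    ∀ᶠ L : ℝ in atTop, a * √L + b * √L * Real.log L ≤ c * (L / Real.log L) := by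
  have h1 : (fun L : ℝ => Real.log L ^ (2 : ℝ)) =o[atTop] fun L : ℝ => L ^ (1 / 2 : ℝ) :=
    isLittleO_log_rpow_rpow_atTop 2 (by norm_num)
  have hη : 0 < c / (|a| + |b| + 1) := by positivity
  filter_upwards [h1.bound hη, Real.tendsto_log_atTop.eventually_ge_atTop 1,
    eventually_gt_atTop 0] with L hL hl hL0
  rw [Real.norm_of_nonneg (by positivity), Real.norm_of_nonneg (by positivity),
    ← Real.sqrt_eq_rpow, Real.rpow_two, div_mul_eq_mul_div, le_div_iff₀ (by positivity)] at hL
  rw [mul_div_assoc', le_div_iff₀ (by positivity)]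
  have hs : 0 < √L := Real.sqrt_pos.2 hL0
  have hs2 : √L * √L = L := Real.mul_self_sqrt hL0.le
  set l := Real.log L
  calc (a * √L + b * √L * l) * l = √L * (a * l + b * l ^ 2) := by ring
    _ ≤ √L * (|a| * l ^ 2 + |b| * l ^ 2) := by
        gcongr ?_ * (?_ + ?_ * _)
        · calc a * l ≤ |a| * l := by gcongr; exact le_abs_self a
            _ ≤ |a| * l ^ 2 := by gcongr; nlinarith
        · exact le_abs_self b
    _ ≤ √L * (l ^ 2 * (|a| + |b| + 1)) := by gcongr; nlinarith [sq_nonneg l]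
    _ ≤ √L * (c * √L) := by gcongr
    _ = c * L := by rw [mul_left_comm, hs2]

/-- The sieve's main term is at least `y * L ^ (-ε / 2)`. With `t = 1 / √L` its error is `√y * exp
(O(√L * log L))`, negligible because `√y ≥ exp ((c / 2) * L / log L)`. -/
theorem eventually_le_card_coprime (K ε c : ℝ) (hε : 0 < ε) (hc : 0 < c) :
    ∀ᶠ L : ℝ in atTop, ∀ M : ℕ, 1 ≤ M → Real.log M ≤ K * L → ∀ y : ℝ,
      Real.exp (c * (L / Real.log L)) ≤ y →
      y * L ^ (-ε) ≤ ((Finset.Icc 1 ⌊y⌋₊).filter fun a => a.Coprime M).card := by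
  have hl2 : 0 < Real.log 2 := Real.log_pos one_lt_two
  filter_upwards [eventually_sum_inv_primeFactors_le K (ε / 4) (by positivity),
    eventually_mul_sqrt_add_le (K / Real.log 2) (ε / 4 + ε) (c / 2) (by positivity),
    eventually_ge_atTop 1,
    (tendsto_rpow_atTop (y := ε / 2) (by positivity)).eventually_ge_atTop 2]
    with L hL1 hL2 hL hL4 M hM hMK y hy
  have hL0 : 0 < L := by linarith
  have hlog0 : 0 ≤ Real.log L := Real.log_nonneg hL
  have hs1 : 1 ≤ √L := Real.one_le_sqrt.2 hL
  have hs : 0 < √L := by linarith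
  have hy0 : 0 < y := (Real.exp_pos _).trans_le hy
  rw [← siftedSet_primeFactors (by omega)]
  have hmain := (abs_le.1 (abs_card_siftedSet_sub_le
    (fun r hr => Nat.prime_of_mem_primeFactors hr) (S := M.primeFactors) y hy0.le)).1
  have hsum := hL1 M hM hMK
  have hprod1 : L ^ (-(ε / 2)) ≤ ∏ p ∈ M.primeFactors, (1 - 1 / (p : ℝ)) := by
    refine le_trans ?_ exp_neg_two_mul_sum_le_prod
    rw [Real.rpow_def_of_pos hL0]
    apply Real.exp_le_exp.2
    linarith
  have hcard : (M.primeFactors.card : ℝ) ≤ K / Real.log 2 * L := by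
    have := (card_primeFactors_le_log M hM).trans hMK
    rwa [div_mul_eq_mul_div, le_div_iff₀ hl2]
  have hprod2 : ∏ p ∈ M.primeFactors, (1 + 1 / √(p : ℝ)) ≤
      Real.exp (K / Real.log 2 * √L + ε / 4 * √L * Real.log L) := by
    refine (prod_one_add_inv_sqrt_le (t := 1 / √L) (by positivity)).trans ?_
    apply Real.exp_le_exp.2
    have hLs : L = √L * √L := (Real.mul_self_sqrt hL0.le).symm
    refine add_le_add ?_ ?_
    · rw [one_div, inv_mul_le_iff₀ hs]
      refine hcard.trans (le_of_eq ?_)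
      nth_rewrite 1 [hLs]
      ring
    · rw [div_div_eq_mul_div, div_one, mul_comm]
      calc √L * ∑ p ∈ M.primeFactors, (1 : ℝ) / p ≤ √L * (ε / 4 * Real.log L) := by gcongr
        _ = _ := by ring
  have hsy : Real.exp (c / 2 * (L / Real.log L)) ≤ √y := by
    apply Real.le_sqrt_of_sq_le
    rw [← Real.exp_nat_mul]
    refine le_trans (le_of_eq ?_) hy
    congr 1
    push_cast
    ring
  have herr : ∏ p ∈ M.primeFactors, (1 + 1 / √(p : ℝ)) ≤ √y * L ^ (-ε) := by
    refine hprod2.trans ?_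
    have : Real.exp (c / 2 * (L / Real.log L)) * L ^ (-ε) ≤ √y * L ^ (-ε) := by gcongr
    refine le_trans ?_ this
    rw [Real.rpow_def_of_pos hL0, ← Real.exp_add]
    apply Real.exp_le_exp.2
    have : ε * Real.log L ≤ ε * √L * Real.log L := by
      gcongr
      nlinarith
    linarith
  have hyy : √y * √y = y := Real.mul_self_sqrt hy0.le
  have hrp : 2 * L ^ (-ε) ≤ L ^ (-(ε / 2)) := by
    calc 2 * L ^ (-ε) ≤ L ^ (ε / 2) * L ^ (-ε) := by gcongr
      _ = _ := by rw [← Real.rpow_add hL0]; congr 1; ring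
  have h1 : √y * ∏ p ∈ M.primeFactors, (1 + 1 / √(p : ℝ)) ≤ y * L ^ (-ε) := by
    calc _ ≤ √y * (√y * L ^ (-ε)) := by gcongr
      _ = _ := by rw [← mul_assoc, hyy]
  have h2 : y * (2 * L ^ (-ε)) ≤ y * ∏ p ∈ M.primeFactors, (1 - 1 / (p : ℝ)) := by
    gcongr
    exact hrp.trans hprod1
  linarith

theorem eventually_le_totient (ε : ℝ) (hε : 0 < ε) :
    ∀ᶠ L : ℝ in atTop, ∀ q : ℕ, 1 ≤ q → Real.log q = L → (q : ℝ) * L ^ (-ε) ≤ q.totient := by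
  filter_upwards [eventually_sum_inv_primeFactors_le 1 (ε / 2) (by positivity),
    eventually_gt_atTop 0] with L hL hL0 q hq hqL
  have h := Nat.totient_eq_mul_prod_factors q
  have h' : ((q.totient : ℚ) : ℝ) = ((q * ∏ p ∈ q.primeFactors, (1 - (p : ℚ)⁻¹) : ℚ) : ℝ) := by
    rw [h]
  push_cast at h'
  rw [h']
  gcongr
  simp_rw [← one_div]
  refine le_trans ?_ exp_neg_two_mul_sum_le_prod
  rw [Real.rpow_def_of_pos hL0]
  apply Real.exp_le_exp.2
  have := hL q hq (by linarith)
  linarith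

/-! ### Coprime matrices and equal products -/

open Classical in
-- Choose the coordinates one at a time, each coprime to `q` times the product of those already
-- chosen. Coordinates not yet chosen are set to `1`, which keeps every modulus within `q * X ^
-- |ι|`.
theorem prod_le_card_pairwise_coprime {ι : Type*} [Fintype ι] [DecidableEq ι]
    (W : ι → Finset ℕ) (c : ι → ℕ) (q X : ℕ) (hq : 1 ≤ q) (hX : 1 ≤ X)
    (hW : ∀ i, ∀ a ∈ W i, 1 ≤ a ∧ a ≤ X)
    (h : ∀ M, 1 ≤ M → M ≤ q * X ^ Fintype.card ι → ∀ i,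
      c i ≤ ((W i).filter fun a => a.Coprime M).card) :
    ∏ i, c i ≤ ((Fintype.piFinset W).filter fun a =>
      (∀ i, (a i).Coprime q) ∧ Pairwise fun i j => (a i).Coprime (a j)).card := by
  let A : Finset ι → Finset (ι → ℕ) := fun s =>
    (Fintype.piFinset fun i => if i ∈ s then W i else {1}).filter fun a =>
      (∀ i, (a i).Coprime q) ∧ Pairwise fun i j => (a i).Coprime (a j)
  suffices H : ∀ s : Finset ι, ∏ i ∈ s, c i ≤ (A s).card by
    simpa [A] using H Finset.univ
  intro s
  induction s using Finset.induction_on with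
  | empty =>
    rw [Finset.prod_empty, Nat.one_le_iff_ne_zero, ← Nat.pos_iff_ne_zero, Finset.card_pos]
    exact ⟨fun _ => 1, by simp [A, Pairwise]⟩
  | insert j s hj ih =>
    rw [Finset.prod_insert hj]
    let N : (ι → ℕ) → ℕ := fun a => q * ∏ i, a i
    have hA1 : ∀ a ∈ A s, a j = 1 := by
      intro a ha
      have := (Fintype.mem_piFinset.1 (Finset.mem_filter.1 ha).1) j
      simpa [hj] using this
    have hAX : ∀ a ∈ A s, ∀ i, 1 ≤ a i ∧ a i ≤ X := by
      intro a ha i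
      have := (Fintype.mem_piFinset.1 (Finset.mem_filter.1 ha).1) i
      by_cases hi : i ∈ s
      · rw [if_pos hi] at this
        exact hW i _ this
      · rw [if_neg hi, Finset.mem_singleton] at this
        rw [this]
        exact ⟨le_rfl, hX⟩
    let V : (ι → ℕ) → Finset ℕ := fun a => (W j).filter fun b => b.Coprime (N a)
    have hc : ∀ a ∈ A s, c j ≤ (V a).card := by
      intro a ha
      refine h _ (Nat.mul_pos hq (Finset.prod_pos fun i _ => (hAX a ha i).1)) ?_ j
      refine Nat.mul_le_mul_left q ?_
      rw [← Finset.card_univ]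
      exact Finset.prod_le_pow_card _ _ _ fun i _ => (hAX a ha i).2
    calc c j * ∏ i ∈ s, c i ≤ c j * (A s).card := Nat.mul_le_mul_left _ ih
      _ ≤ ∑ a ∈ A s, (V a).card := by
        rw [mul_comm, ← smul_eq_mul]
        exact Finset.card_nsmul_le_sum _ _ _ hc
      _ = ((A s).sigma V).card := (Finset.card_sigma _ _).symm
      _ ≤ (A (insert j s)).card := by
        refine Finset.card_le_card_of_injOn (fun z => Function.update z.1 j z.2) ?_ ?_
        · rintro ⟨a, b⟩ hab
          rw [Finset.mem_coe, Finset.mem_sigma] at hab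
          obtain ⟨ha, hb⟩ := hab
          have hb' := Finset.mem_filter.1 hb
          have ha' := Finset.mem_filter.1 ha
          have hbq : b.Coprime q := hb'.2.coprime_mul_right_right
          have hba : ∀ i, b.Coprime (a i) := fun i =>
            (hb'.2.coprime_mul_left_right).coprime_dvd_right
              (Finset.dvd_prod_of_mem a (Finset.mem_univ i))
          refine Finset.mem_coe.2 (Finset.mem_filter.2 ⟨Fintype.mem_piFinset.2 fun i => ?_, ?_, ?_⟩)
          · have hi := Fintype.mem_piFinset.1 ha'.1 i
            rcases eq_or_ne i j with rfl | hij
            · simpa using hb'.1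
            · simpa [hij] using hi
          · intro i
            rcases eq_or_ne i j with rfl | hij
            · simpa using hbq
            · simpa [hij] using ha'.2.1 i
          · intro i i' hne
            rcases eq_or_ne i j with rfl | hij
            · simpa [hne.symm] using hba i'
            · rcases eq_or_ne i' j with rfl | hij'
              · simpa [hij] using (hba i).symm
              · simpa [hij, hij'] using ha'.2.2 hne
        · rintro ⟨a, b⟩ ha ⟨a', b'⟩ ha' heq
          rw [Finset.mem_coe, Finset.mem_sigma] at ha ha'
          simp only at heq
          have hb : b = b' := by simpa using congrFun heq j
          subst hb
          have : a = a' := by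
            funext i
            rcases eq_or_ne i j with rfl | hij
            · rw [hA1 a ha.1, hA1 a' ha'.1]
            · simpa [hij] using congrFun heq i
          rw [this]

open Classical in
/-- The `m × m` matrices with entries in `[1, X]` that are pairwise coprime and coprime to `q`, all
of whose row and column products are at most `X`. -/
noncomputable def coprimeMatrices (m q X : ℕ) : Finset (Fin m × Fin m → ℕ) :=
  (Fintype.piFinset fun _ => Finset.Icc 1 X).filter fun a =>
    ((∀ i, (a i).Coprime q) ∧ Pairwise fun i j => (a i).Coprime (a j)) ∧
      (∀ i, ∏ j, a (i, j) ≤ X) ∧ ∀ j, ∏ i, a (i, j) ≤ X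

/-- The solutions of `n₁ ⋯ nₘ = n'₁ ⋯ n'ₘ` in integers in `[1, X]` coprime to `q`. -/
def equalProducts (m q X : ℕ) : Finset ((Fin m → ℕ) × (Fin m → ℕ)) :=
  ((Fintype.piFinset fun _ => (Finset.Icc 1 X).filter fun a => a.Coprime q) ×ˢ
    (Fintype.piFinset fun _ => (Finset.Icc 1 X).filter fun a => a.Coprime q)).filter
      fun z => ∏ i, z.1 i = ∏ i, z.2 i

theorem gcd_prod_row_prod_col {m : ℕ} {a : Fin m × Fin m → ℕ}
    (ha : Pairwise fun i j => (a i).Coprime (a j)) (i j : Fin m) :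
    Nat.gcd (∏ j', a (i, j')) (∏ i', a (i', j)) = a (i, j) := by
  rw [← Finset.mul_prod_erase _ (fun j' => a (i, j')) (Finset.mem_univ j),
    ← Finset.mul_prod_erase _ (fun i' => a (i', j)) (Finset.mem_univ i),
    Nat.gcd_mul_left]
  have : Nat.Coprime (∏ x ∈ Finset.univ.erase j, a (i, x))
      (∏ x ∈ Finset.univ.erase i, a (x, j)) := by
    refine Nat.Coprime.prod_left fun j' hj' => Nat.Coprime.prod_right fun i' _ => ha ?_
    intro h
    exact (Finset.ne_of_mem_erase hj') (Prod.ext_iff.1 h).2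
  rw [this.gcd_eq_one, mul_one]

open Classical in
theorem card_coprimeMatrices_le (m q X : ℕ) :
    (coprimeMatrices m q X).card ≤ (equalProducts m q X).card := by
  refine Finset.card_le_card_of_injOn
    (fun a => (fun i => ∏ j, a (i, j), fun j => ∏ i, a (i, j))) ?_ ?_
  · intro a ha
    obtain ⟨h1, ⟨h2, -⟩, h3, h4⟩ := Finset.mem_filter.1 (Finset.mem_coe.1 ha)
    have hpos : ∀ i, 1 ≤ a i := fun i => (Finset.mem_Icc.1 (Fintype.mem_piFinset.1 h1 i)).1
    have hr : ∀ i, 1 ≤ ∏ j, a (i, j) := fun i =>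
      Nat.succ_le_of_lt (Finset.prod_pos fun j _ => hpos _)
    have hc : ∀ j, 1 ≤ ∏ i, a (i, j) := fun j =>
      Nat.succ_le_of_lt (Finset.prod_pos fun i _ => hpos _)
    have hrq : ∀ i, (∏ j, a (i, j)).Coprime q := fun i => Nat.Coprime.prod_left fun j _ => h2 _
    have hcq : ∀ j, (∏ i, a (i, j)).Coprime q := fun j => Nat.Coprime.prod_left fun i _ => h2 _
    refine Finset.mem_coe.2 (Finset.mem_filter.2 ⟨Finset.mem_product.2 ⟨?_, ?_⟩, ?_⟩)
    · exact Fintype.mem_piFinset.2 fun i =>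
        Finset.mem_filter.2 ⟨Finset.mem_Icc.2 ⟨hr i, h3 i⟩, hrq i⟩
    · exact Fintype.mem_piFinset.2 fun j =>
        Finset.mem_filter.2 ⟨Finset.mem_Icc.2 ⟨hc j, h4 j⟩, hcq j⟩
    · exact (Finset.prod_comm : ∏ i, ∏ j, a (i, j) = ∏ j, ∏ i, a (i, j))
  · intro a ha b hb hab
    have ha' := (Finset.mem_filter.1 (Finset.mem_coe.1 ha)).2.1.2
    have hb' := (Finset.mem_filter.1 (Finset.mem_coe.1 hb)).2.1.2
    rw [Prod.mk.injEq] at hab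
    funext ⟨i, j⟩
    rw [← gcd_prod_row_prod_col ha', ← gcd_prod_row_prod_col hb']
    exact congrArg₂ Nat.gcd (congrFun hab.1 i) (congrFun hab.2 j)

/-! ### Exponent matrices with constant margins -/

/-- The square matrix with block `B + f` and constant row and column sums `(n + 1) * B`. -/
def exponentMatrix {n : ℕ} (B : ℕ) (f : Fin n × Fin n → ℕ) : Fin (n + 1) × Fin (n + 1) → ℕ :=
  fun z => Fin.lastCases (motive := fun _ => ℕ)
    (Fin.lastCases (motive := fun _ => ℕ) (B + ∑ i, ∑ j, f (i, j)) (fun j => B - ∑ i, f (i, j)) z.2)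
    (fun i => Fin.lastCases (motive := fun _ => ℕ) (B - ∑ j, f (i, j)) (fun j => B + f (i, j)) z.2)
    z.1

section
variable {n B F : ℕ} {f : Fin n × Fin n → ℕ}

theorem exponentMatrix_castSucc (i j : Fin n) :
    exponentMatrix B f (i.castSucc, j.castSucc) = B + f (i, j) := by
  simp [exponentMatrix]

theorem sum_row_le_of_forall_lt (hf : ∀ z, f z < F) (i : Fin n) : ∑ j, f (i, j) ≤ n * F := by
  simpa using Finset.sum_le_card_nsmul Finset.univ (fun j => f (i, j)) F fun j _ => (hf _).le

theorem sum_col_le_of_forall_lt (hf : ∀ z, f z < F) (j : Fin n) : ∑ i, f (i, j) ≤ n * F := by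
  simpa using Finset.sum_le_card_nsmul Finset.univ (fun i => f (i, j)) F fun i _ => (hf _).le

/-- Border corrections are at most `n * F ≤ B / 2`, so every window stays long enough for the sieve.
-/
theorem le_two_mul_exponentMatrix (hF : 2 * (n * F) ≤ B) (hf : ∀ z, f z < F)
    (z : Fin (n + 1) × Fin (n + 1)) : B ≤ 2 * exponentMatrix B f z := by
  obtain ⟨i, j⟩ := z
  induction i using Fin.lastCases with
  | last =>
    induction j using Fin.lastCases with
    | last => simp only [exponentMatrix, Fin.lastCases_last]; omega
    | cast j =>
      have := sum_col_le_of_forall_lt hf j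
      simp only [exponentMatrix, Fin.lastCases_last, Fin.lastCases_castSucc]; omega
  | cast i =>
    induction j using Fin.lastCases with
    | last =>
      have := sum_row_le_of_forall_lt hf i
      simp only [exponentMatrix, Fin.lastCases_last, Fin.lastCases_castSucc]; omega
    | cast j => rw [exponentMatrix_castSucc]; omega

theorem sum_row_exponentMatrix (hF : 2 * (n * F) ≤ B) (hf : ∀ z, f z < F) (i : Fin (n + 1)) :
    ∑ j, exponentMatrix B f (i, j) = (n + 1) * B := by
  have hc : ∀ j, (∑ i, f (i, j)) ≤ B := fun j => by
    have := sum_col_le_of_forall_lt hf j; omega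
  rw [Fin.sum_univ_castSucc]
  induction i using Fin.lastCases with
  | last =>
    simp only [exponentMatrix, Fin.lastCases_last, Fin.lastCases_castSucc]
    rw [Finset.sum_comm, add_left_comm, ← Finset.sum_add_distrib,
      Finset.sum_congr rfl fun j _ => Nat.sub_add_cancel (hc j)]
    simp
    ring
  | cast i =>
    have := sum_row_le_of_forall_lt hf i
    simp only [exponentMatrix, Fin.lastCases_last, Fin.lastCases_castSucc,
      Finset.sum_add_distrib, Finset.sum_const, Finset.card_univ, Fintype.card_fin, smul_eq_mul]
    rw [add_assoc, Nat.add_sub_cancel' (by omega)]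
    ring

theorem sum_col_exponentMatrix (hF : 2 * (n * F) ≤ B) (hf : ∀ z, f z < F) (j : Fin (n + 1)) :
    ∑ i, exponentMatrix B f (i, j) = (n + 1) * B := by
  have hc : ∀ i, (∑ j, f (i, j)) ≤ B := fun i => by
    have := sum_row_le_of_forall_lt hf i; omega
  rw [Fin.sum_univ_castSucc]
  induction j using Fin.lastCases with
  | last =>
    simp only [exponentMatrix, Fin.lastCases_last, Fin.lastCases_castSucc]
    rw [add_left_comm, ← Finset.sum_add_distrib,
      Finset.sum_congr rfl fun j _ => Nat.sub_add_cancel (hc j)]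
    simp
    ring
  | cast j =>
    have := sum_col_le_of_forall_lt hf j
    simp only [exponentMatrix, Fin.lastCases_last, Fin.lastCases_castSucc,
      Finset.sum_add_distrib, Finset.sum_const, Finset.card_univ, Fintype.card_fin, smul_eq_mul]
    rw [add_assoc, Nat.add_sub_cancel' (by omega)]
    ring

end

open Classical in
-- Each of the `F ^ (n * n)` blocks `f` yields a box of windows, filled greedily. Windows with
-- different exponents are disjoint, so a matrix determines `f` and the counts add. The upper ends
-- `T ^ (e + 1)` cost one extra exponent per entry, hence `B + 1` in `hX`.
theorem le_card_coprimeMatrices (n B F T q X : ℕ) (hT : 2 ≤ T) (hq : 1 ≤ q)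
    (hF : 2 * (n * F) ≤ B) (hX : T ^ ((n + 1) * (B + 1)) ≤ X)
    (h : ∀ M, 1 ≤ M → M ≤ q * X ^ ((n + 1) * (n + 1)) → ∀ e, B ≤ 2 * e →
      T ^ e ≤ ((Finset.Ioc (T ^ e) (T ^ (e + 1))).filter fun a => a.Coprime M).card) :
    F ^ (n * n) * T ^ ((n + 1) * ((n + 1) * B)) ≤ (coprimeMatrices (n + 1) q X).card := by
  have hT0 : 0 < T := by omega
  have hX1 : 1 ≤ X := (Nat.pow_pos hT0).trans_le hX
  let I : Finset (Fin n × Fin n → ℕ) := Fintype.piFinset fun _ => Finset.range F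
  let W : (Fin n × Fin n → ℕ) → Fin (n + 1) × Fin (n + 1) → Finset ℕ := fun f z =>
    Finset.Ioc (T ^ exponentMatrix B f z) (T ^ (exponentMatrix B f z + 1))
  let D : (Fin n × Fin n → ℕ) → Finset (Fin (n + 1) × Fin (n + 1) → ℕ) := fun f =>
    (Fintype.piFinset (W f)).filter fun a =>
      (∀ i, (a i).Coprime q) ∧ Pairwise fun i j => (a i).Coprime (a j)
  have hI : ∀ f ∈ I, ∀ z, f z < F := fun f hf z =>
    Finset.mem_range.1 (Fintype.mem_piFinset.1 hf z)
  have hrow : ∀ f ∈ I, ∀ a : Fin (n + 1) × Fin (n + 1) → ℕ, (∀ z, a z ∈ W f z) →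
      ∀ i, ∏ j, a (i, j) ≤ X := by
    intro f hf a ha i
    refine le_trans (le_trans (Finset.prod_le_prod' fun j _ => (Finset.mem_Ioc.1 (ha (i, j))).2)
      (le_of_eq ?_)) hX
    rw [Finset.prod_pow_eq_pow_sum, Finset.sum_add_distrib, sum_row_exponentMatrix hF (hI f hf)]
    simp [mul_add]
  have hcol : ∀ f ∈ I, ∀ a : Fin (n + 1) × Fin (n + 1) → ℕ, (∀ z, a z ∈ W f z) →
      ∀ j, ∏ i, a (i, j) ≤ X := by
    intro f hf a ha j
    refine le_trans (le_trans (Finset.prod_le_prod' fun i _ => (Finset.mem_Ioc.1 (ha (i, j))).2)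
      (le_of_eq ?_)) hX
    rw [Finset.prod_pow_eq_pow_sum, Finset.sum_add_distrib, sum_col_exponentMatrix hF (hI f hf)]
    simp [mul_add]
  have hWX : ∀ f ∈ I, ∀ z, ∀ b ∈ W f z, 1 ≤ b ∧ b ≤ X := by
    intro f hf z b hb
    have hb' := Finset.mem_Ioc.1 hb
    refine ⟨(Nat.zero_le _).trans_lt hb'.1, hb'.2.trans (le_trans ?_ hX)⟩
    refine Nat.pow_le_pow_right hT0 ?_
    have h1 := sum_row_exponentMatrix hF (hI f hf) z.1
    have h2 : exponentMatrix B f (z.1, z.2) ≤ ∑ j, exponentMatrix B f (z.1, j) :=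
      Finset.single_le_sum (f := fun j => exponentMatrix B f (z.1, j)) (fun _ _ => Nat.zero_le _)
        (Finset.mem_univ z.2)
    calc exponentMatrix B f z + 1 ≤ (n + 1) * B + (n + 1) := by
          refine add_le_add (h2.trans h1.le) (by omega)
      _ = _ := by ring
  have hDcard : ∀ f ∈ I, T ^ ((n + 1) * ((n + 1) * B)) ≤ (D f).card := by
    intro f hf
    have := prod_le_card_pairwise_coprime (W f) (fun z => T ^ exponentMatrix B f z) q X hq hX1
      (hWX f hf) (fun M hM1 hM2 z => h M hM1 (by simpa using hM2) _
        (le_two_mul_exponentMatrix hF (hI f hf) z))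
    refine le_trans (le_of_eq ?_) this
    rw [Finset.prod_pow_eq_pow_sum, Fintype.sum_prod_type]
    simp only [sum_row_exponentMatrix hF (hI f hf)]
    simp
  have hDsub : ∀ f ∈ I, D f ⊆ coprimeMatrices (n + 1) q X := by
    intro f hf a ha
    obtain ⟨h1, h2⟩ := Finset.mem_filter.1 ha
    have h1' := Fintype.mem_piFinset.1 h1
    exact Finset.mem_filter.2 ⟨Fintype.mem_piFinset.2 fun z =>
      Finset.mem_Icc.2 (hWX f hf z _ (h1' z)), h2, hrow f hf a h1', hcol f hf a h1'⟩
  have hdisj : (I : Set (Fin n × Fin n → ℕ)).PairwiseDisjoint D := by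
    intro f _ g _ hfg
    rw [Function.onFun, Finset.disjoint_left]
    intro a haf hag
    apply hfg
    funext ⟨i, j⟩
    have hf := Finset.mem_Ioc.1
      (Fintype.mem_piFinset.1 (Finset.mem_filter.1 haf).1 (i.castSucc, j.castSucc))
    have hg := Finset.mem_Ioc.1
      (Fintype.mem_piFinset.1 (Finset.mem_filter.1 hag).1 (i.castSucc, j.castSucc))
    rw [exponentMatrix_castSucc] at hf hg
    have k1 := (Nat.pow_lt_pow_iff_right (by omega : 1 < T)).1 (hf.1.trans_le hg.2)
    have k2 := (Nat.pow_lt_pow_iff_right (by omega : 1 < T)).1 (hg.1.trans_le hf.2)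
    omega
  calc F ^ (n * n) * T ^ ((n + 1) * ((n + 1) * B))
      = I.card * T ^ ((n + 1) * ((n + 1) * B)) := by
        congr 1
        simp [I, Fintype.card_piFinset]
    _ ≤ ∑ f ∈ I, (D f).card := by
        rw [← smul_eq_mul]
        exact Finset.card_nsmul_le_sum _ _ _ hDcard
    _ = (I.biUnion D).card := (Finset.card_biUnion hdisj).symm
    _ ≤ _ := Finset.card_le_card (Finset.biUnion_subset.2 hDsub)

/-! ### Moments of character sums -/

theorem DirichletCharacter.star_apply_eq_apply_inv {q : ℕ} [NeZero q]
    (χ : DirichletCharacter ℂ q) {a : ZMod q} (ha : IsUnit a) :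
    (starRingEnd ℂ) (χ a) = χ a⁻¹ := by
  have h1 : χ a * χ a⁻¹ = 1 := by
    rw [← map_mul, ZMod.mul_inv_of_unit a ha, map_one]
  have h2 : χ a * (starRingEnd ℂ) (χ a) = 1 := by
    rw [Complex.mul_conj, Complex.normSq_eq_norm_sq]
    obtain ⟨u, rfl⟩ := ha
    rw [DirichletCharacter.unit_norm_eq_one]
    simp
  exact mul_left_cancel₀ (left_ne_zero_of_mul_eq_one h1) (h2.trans h1.symm)

theorem sum_character_eq_sum_coprime {q : ℕ} (χ : DirichletCharacter ℂ q) (X : ℕ) :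
    ∑ n ∈ Finset.Icc 1 X, χ (n : ZMod q) =
      ∑ n ∈ (Finset.Icc 1 X).filter fun a => a.Coprime q, χ (n : ZMod q) := by
  rw [Finset.sum_filter]
  refine Finset.sum_congr rfl fun n _ => ?_
  split_ifs with h
  · rfl
  · exact MulChar.map_nonunit χ (fun hu => h ((ZMod.isUnit_iff_coprime n q).1 hu))

theorem totient_mul_card_equalProducts_le {q : ℕ} [NeZero q] (m X : ℕ) :
    (q.totient : ℝ) * (equalProducts m q X).card ≤
      ∑ χ : DirichletCharacter ℂ q, ‖∑ n ∈ Finset.Icc 1 X, χ (n : ZMod q)‖ ^ (2 * m) := by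
  set V : Finset (Fin m → ℕ) :=
    Fintype.piFinset fun _ => (Finset.Icc 1 X).filter fun a => a.Coprime q with hV
  have hpow : ∀ χ : DirichletCharacter ℂ q, (∑ n ∈ Finset.Icc 1 X, χ (n : ZMod q)) ^ m =
      ∑ v ∈ V, χ ((∏ i, v i : ℕ) : ZMod q) := by
    intro χ
    rw [sum_character_eq_sum_coprime, hV]
    have := Finset.prod_univ_sum (fun _ : Fin m => (Finset.Icc 1 X).filter fun a => a.Coprime q)
      (fun _ n => χ (n : ZMod q))
    rw [Finset.prod_const, Finset.card_univ, Fintype.card_fin] at this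
    rw [this]
    refine Finset.sum_congr rfl fun v _ => ?_
    rw [Nat.cast_prod, map_prod]
  have hunit : ∀ v ∈ V, IsUnit ((∏ i, v i : ℕ) : ZMod q) := by
    intro v hv
    rw [ZMod.isUnit_iff_coprime]
    exact Nat.Coprime.prod_left fun i _ =>
      (Finset.mem_filter.1 (Fintype.mem_piFinset.1 hv i)).2
  have hcomplex : ((∑ χ : DirichletCharacter ℂ q,
      ‖∑ n ∈ Finset.Icc 1 X, χ (n : ZMod q)‖ ^ (2 * m) : ℝ) : ℂ) =
      ((∑ z ∈ V ×ˢ V, if ((∏ i, z.2 i : ℕ) : ZMod q) = ((∏ i, z.1 i : ℕ) : ZMod q)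
        then (q.totient : ℝ) else 0 : ℝ) : ℂ) := by
    rw [Complex.ofReal_sum, Complex.ofReal_sum]
    simp only [Complex.ofReal_pow]
    have h1 : ∀ χ : DirichletCharacter ℂ q,
        (‖∑ n ∈ Finset.Icc 1 X, χ (n : ZMod q)‖ : ℂ) ^ (2 * m) =
          ∑ z ∈ V ×ˢ V, χ ((∏ i, z.2 i : ℕ) : ZMod q)⁻¹ * χ ((∏ i, z.1 i : ℕ) : ZMod q) := by
      intro χ
      rw [pow_mul, ← Complex.mul_conj', mul_pow, ← map_pow, hpow, map_sum, Finset.sum_mul_sum,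
        Finset.sum_product]
      refine Finset.sum_congr rfl fun v _ => Finset.sum_congr rfl fun w hw => ?_
      rw [DirichletCharacter.star_apply_eq_apply_inv χ (hunit w hw), mul_comm]
    rw [Finset.sum_congr rfl fun χ _ => h1 χ, Finset.sum_comm]
    refine Finset.sum_congr rfl fun z hz => ?_
    rw [DirichletCharacter.sum_char_inv_mul_char_eq ℂ (hunit _ (Finset.mem_product.1 hz).2)]
    split_ifs <;> simp
  rw [Complex.ofReal_injective hcomplex]
  calc (q.totient : ℝ) * (equalProducts m q X).card
      = ∑ z ∈ equalProducts m q X, (q.totient : ℝ) := by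
        rw [Finset.sum_const, nsmul_eq_mul, mul_comm]
    _ = ∑ z ∈ equalProducts m q X, if ((∏ i, z.2 i : ℕ) : ZMod q) = ((∏ i, z.1 i : ℕ) : ZMod q)
        then (q.totient : ℝ) else 0 := by
        refine Finset.sum_congr rfl fun z hz => ?_
        rw [if_pos]
        rw [(Finset.mem_filter.1 hz).2]
    -- Congruent but unequal products contribute nonnegatively and are dropped.
    _ ≤ _ := by
        refine Finset.sum_le_sum_of_subset_of_nonneg (Finset.filter_subset _ _) fun z _ _ => ?_
        split_ifs <;> positivity

theorem norm_sum_character_one_le {q : ℕ} (X : ℕ) :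
    ‖∑ n ∈ Finset.Icc 1 X, (1 : DirichletCharacter ℂ q) (n : ZMod q)‖ ≤
      ((Finset.Icc 1 X).filter fun a => a.Coprime q).card := by
  rw [sum_character_eq_sum_coprime]
  refine (norm_sum_le _ _).trans ?_
  refine (Finset.sum_le_card_nsmul _ _ 1 fun n _ => DirichletCharacter.norm_le_one _ _).trans ?_
  simp

theorem exists_character_le_norm_pow {q : ℕ} [NeZero q] (m X : ℕ) {A : ℝ} (hA : 0 < A)
    (h : (((Finset.Icc 1 X).filter fun a => a.Coprime q).card : ℝ) ^ (2 * m) + q.totient * A ≤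
      q.totient * (equalProducts m q X).card) :
    ∃ χ : DirichletCharacter ℂ q, χ ≠ 1 ∧
      A ≤ ‖∑ n ∈ Finset.Icc 1 X, χ (n : ZMod q)‖ ^ (2 * m) := by
  by_contra! hcon
  have h1 := totient_mul_card_equalProducts_le (q := q) m X
  rw [← Finset.add_sum_erase _ _ (Finset.mem_univ (1 : DirichletCharacter ℂ q))] at h1
  have h2 : ∑ χ ∈ Finset.univ.erase (1 : DirichletCharacter ℂ q),
      ‖∑ n ∈ Finset.Icc 1 X, χ (n : ZMod q)‖ ^ (2 * m) ≤ (q.totient - 1) * A := by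
    refine (Finset.sum_le_card_nsmul _ _ A fun χ hχ =>
      (hcon χ (Finset.ne_of_mem_erase hχ)).le).trans (le_of_eq ?_)
    rw [Finset.card_erase_of_mem (Finset.mem_univ _), Finset.card_univ, ← Nat.card_eq_fintype_card,
      DirichletCharacter.card_eq_totient_of_hasEnoughRootsOfUnity, nsmul_eq_mul,
      Nat.cast_pred (Nat.totient_pos.2 (NeZero.pos q))]
  have h3 : ‖∑ n ∈ Finset.Icc 1 X, (1 : DirichletCharacter ℂ q) (n : ZMod q)‖ ^ (2 * m) ≤
      (((Finset.Icc 1 X).filter fun a => a.Coprime q).card : ℝ) ^ (2 * m) :=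
    pow_le_pow_left₀ (norm_nonneg _) (norm_sum_character_one_le X) _
  linarith

theorem card_coprime_lt_totient {q X : ℕ} (h2 : 2 ≤ q) (hX : X + 1 < q) :
    ((Finset.Icc 1 X).filter fun a => a.Coprime q).card < q.totient := by
  rw [Nat.totient_eq_card_coprime]
  refine Finset.card_lt_card (Finset.ssubset_iff_subset_ne.2 ⟨?_, ?_⟩)
  · intro a ha
    simp only [Finset.mem_filter, Finset.mem_Icc, Finset.mem_range] at ha ⊢
    exact ⟨by omega, ha.2.symm⟩
  · intro heq
    have : q - 1 ∈ (Finset.range q).filter q.Coprime := by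
      simp only [Finset.mem_filter, Finset.mem_range]
      refine ⟨by omega, ?_⟩
      obtain ⟨r, rfl⟩ : ∃ r, q = r + 1 := ⟨q - 1, by omega⟩
      simp
    rw [← heq] at this
    simp only [Finset.mem_filter, Finset.mem_Icc] at this
    omega

theorem card_coprime_le_card_equalProducts_one (q X : ℕ) :
    ((Finset.Icc 1 X).filter fun a => a.Coprime q).card ≤ (equalProducts 1 q X).card := by
  refine Finset.card_le_card_of_injOn (fun a => (fun _ => a, fun _ => a)) ?_ ?_
  · intro a ha
    have ha' := Finset.mem_coe.1 ha
    exact Finset.mem_coe.2 (Finset.mem_filter.2 ⟨Finset.mem_product.2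
      ⟨Fintype.mem_piFinset.2 fun _ => ha', Fintype.mem_piFinset.2 fun _ => ha'⟩, rfl⟩)
  · intro a _ b _ hab
    exact congrFun (Prod.ext_iff.1 hab).1 0

/-- Second moment with the `N` diagonal solutions: `N + 1 ≤ φ(q)`, since `q - 1` is coprime to `q`
and exceeds `X`, so `N ^ 2 + φ(q) / q ≤ φ(q) * N`. -/
theorem exists_character_inv_le_norm_sq {q X : ℕ} (h2 : 2 ≤ q) (hX1 : 1 ≤ X) (hX : X + 1 < q) :
    ∃ χ : DirichletCharacter ℂ q, χ ≠ 1 ∧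
      1 / (q : ℝ) ≤ ‖∑ n ∈ Finset.Icc 1 X, χ (n : ZMod q)‖ ^ 2 := by
  have : NeZero q := ⟨by omega⟩
  have hq0 : (0 : ℝ) < q := by exact_mod_cast NeZero.pos q
  refine exists_character_le_norm_pow 1 X (by positivity) ?_
  set N := ((Finset.Icc 1 X).filter fun a => a.Coprime q).card with hN
  have hN1 : (1 : ℝ) ≤ N := by
    have : 0 < N := Finset.card_pos.2 ⟨1, by simp [hX1]⟩
    exact_mod_cast this
  have hlt : (N : ℝ) + 1 ≤ q.totient := by exact_mod_cast card_coprime_lt_totient h2 hX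
  have hle : (N : ℝ) ≤ (equalProducts 1 q X).card := by
    exact_mod_cast card_coprime_le_card_equalProducts_one q X
  have hφ : (q.totient : ℝ) * (1 / q) ≤ 1 := by
    rw [mul_one_div, div_le_one hq0]
    exact_mod_cast Nat.totient_le q
  have : (q.totient : ℝ) * N ≤ q.totient * (equalProducts 1 q X).card := by gcongr
  nlinarith

/-! ### Counting solutions in the required range -/

theorem eventually_le_card_coprime_Ioc (K η c : ℝ) (hη : 0 < η) (hc : 0 < c) :
    ∀ᶠ L : ℝ in atTop, ∀ T : ℕ, L ^ η ≤ T → ∀ M : ℕ, 1 ≤ M → Real.log M ≤ K * L → ∀ e : ℕ,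
      Real.exp (c * (L / Real.log L)) ≤ (T : ℝ) ^ (e + 1) →
      T ^ e ≤ ((Finset.Ioc (T ^ e) (T ^ (e + 1))).filter fun a => a.Coprime M).card := by
  filter_upwards [eventually_le_card_coprime K (η / 2) c (by positivity) hc,
    (tendsto_rpow_atTop (y := η / 2) (by positivity)).eventually_ge_atTop 2,
    eventually_ge_atTop 1] with L h1 h2 h3 T hT M hM hMK e he
  have hL0 : 0 < L := by linarith
  have h := h1 M hM hMK _ he
  have hf : ⌊(T : ℝ) ^ (e + 1)⌋₊ = T ^ (e + 1) := by
    exact_mod_cast Nat.floor_natCast (R := ℝ) (T ^ (e + 1))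
  rw [hf] at h
  have hsub : ((Finset.Icc 1 (T ^ (e + 1))).filter fun a => a.Coprime M) ⊆
      Finset.Icc 1 (T ^ e) ∪
        (Finset.Ioc (T ^ e) (T ^ (e + 1))).filter fun a => a.Coprime M := by
    intro a ha
    simp only [Finset.mem_filter, Finset.mem_Icc, Finset.mem_union, Finset.mem_Ioc] at ha ⊢
    rcases le_or_gt a (T ^ e) with h | h
    · exact Or.inl ⟨ha.1.1, h⟩
    · exact Or.inr ⟨⟨h, ha.1.2⟩, ha.2⟩
  have hcard := (Finset.card_le_card hsub).trans (Finset.card_union_le _ _)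
  rw [Nat.card_Icc, Nat.add_sub_cancel] at hcard
  have h4 : 2 * (T : ℝ) ^ e ≤ (T : ℝ) ^ (e + 1) * L ^ (-(η / 2)) := by
    have : 2 ≤ T * L ^ (-(η / 2)) := by
      calc (2 : ℝ) ≤ L ^ (η / 2) := h2
        _ = L ^ η * L ^ (-(η / 2)) := by rw [← Real.rpow_add hL0]; congr 1; ring
        _ ≤ _ := by gcongr
    calc 2 * (T : ℝ) ^ e ≤ T * L ^ (-(η / 2)) * (T : ℝ) ^ e := by gcongr
      _ = _ := by ring
  have h5 : 2 * T ^ e ≤ ((Finset.Icc 1 (T ^ (e + 1))).filter fun a => a.Coprime M).card := by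
    have := h4.trans h
    exact_mod_cast this
  omega

theorem eventually_rpow_one_sub_add_le (η c b : ℝ) (hη : 0 < η) (hη1 : η ≤ 1) (hc : 0 < c) :
    ∀ᶠ L : ℝ in atTop, L ^ (1 - η) + b ≤ c * (L / Real.log L ^ 2) := by
  have h1 : (fun L : ℝ => Real.log L ^ (2 : ℝ)) =o[atTop] fun L : ℝ => L ^ η :=
    isLittleO_log_rpow_rpow_atTop 2 hη
  have hd : 0 < c / (1 + |b|) := by positivity
  filter_upwards [h1.bound hd, Real.tendsto_log_atTop.eventually_ge_atTop 1,
    eventually_ge_atTop 1] with L hL hl hL1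
  have hL0 : 0 < L := by linarith
  rw [Real.norm_of_nonneg (by positivity), Real.norm_of_nonneg (by positivity),
    Real.rpow_two, div_mul_eq_mul_div, le_div_iff₀ (by positivity)] at hL
  rw [mul_div_assoc', le_div_iff₀ (by positivity)]
  have h2 : 1 ≤ L ^ (1 - η) := Real.one_le_rpow hL1 (by linarith)
  calc (L ^ (1 - η) + b) * Real.log L ^ 2 ≤ (L ^ (1 - η) + |b| * L ^ (1 - η)) * Real.log L ^ 2 := by
        gcongr
        calc b ≤ |b| * 1 := by rw [mul_one]; exact le_abs_self b
          _ ≤ _ := by gcongr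
    _ = L ^ (1 - η) * (Real.log L ^ 2 * (1 + |b|)) := by ring
    _ ≤ L ^ (1 - η) * (c * L ^ η) := by gcongr
    _ = c * (L ^ (1 - η) * L ^ η) := by ring
    _ = c * L := by rw [← Real.rpow_add hL0]; simp

theorem eventually_le_card_equalProducts (n : ℕ) (η : ℝ) (hη : 0 < η) (hη1 : η ≤ 1) :
    ∀ᶠ L : ℝ in atTop, ∀ q : ℕ, 1 ≤ q → Real.log q = L → ∀ x : ℝ,
      Real.exp (L / Real.log L) ≤ x → x ≤ q →
      x ^ (n + 1) * L ^ ((1 - η) * (n * n : ℕ) - η * (4 * (n + 1) ^ 2 : ℕ)) ≤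
        (equalProducts (n + 1) q ⌊x⌋₊).card := by
  set k : ℝ := (n : ℝ) + 1 with hk
  have hk1 : 1 ≤ k := by
    have : (0 : ℝ) ≤ n := by positivity
    linarith
  have hk0 : 0 < k := by linarith
  filter_upwards [eventually_le_card_coprime_Ioc (1 + k * k) η (1 / (2 * k)) hη (by positivity),
    eventually_rpow_one_sub_add_le η (1 / (4 * k ^ 2)) 2 hη hη1 (by positivity),
    (tendsto_rpow_atTop (y := η) hη).eventually_ge_atTop 2,
    Real.tendsto_log_atTop.eventually_ge_atTop 1, eventually_ge_atTop 1]
    with L hwin hF hLη hlog hL1 q hq hqL x hx hxq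
  have hL0 : 0 < L := by linarith
  have hx1 : 1 ≤ x := (Real.one_le_exp (by positivity)).trans hx
  have hx0 : 0 < x := by linarith
  have hlogx : L / Real.log L ≤ Real.log x := (Real.le_log_iff_exp_le hx0).2 hx
  set T := ⌈L ^ η⌉₊ with hT
  have hT1 : L ^ η ≤ T := Nat.le_ceil _
  have hT2 : (T : ℝ) ≤ 2 * L ^ η := by
    have := Nat.ceil_lt_add_one (show 0 ≤ L ^ η by positivity)
    linarith
  have hTtwo : (2 : ℝ) ≤ T := hLη.trans hT1
  have hTnat : 2 ≤ T := by exact_mod_cast hTtwo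
  have hT0 : (0 : ℝ) < T := by linarith
  have hlogT0 : 0 < Real.log T := Real.log_pos (by linarith)
  have hlogT : Real.log T ≤ 2 * Real.log L := by
    calc Real.log T ≤ Real.log (L ^ η * L ^ η) := by
          apply Real.log_le_log hT0
          nlinarith
      _ = 2 * (η * Real.log L) := by
          rw [Real.log_mul (by positivity) (by positivity), Real.log_rpow hL0]; ring
      _ ≤ 2 * (1 * Real.log L) := by gcongr
      _ = _ := by ring
  have hL2 : 0 < L / Real.log L ^ 2 := by positivity
  set u := Real.log x / (k * Real.log T) with hu
  have hu0 : L / (2 * k * Real.log L ^ 2) ≤ u := by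
    rw [hu, div_le_div_iff₀ (by positivity) (by positivity)]
    rw [div_le_iff₀ (by positivity)] at hlogx
    have hlx0 := Real.log_nonneg hx1
    calc L * (k * Real.log T) ≤ (Real.log x * Real.log L) * (k * (2 * Real.log L)) := by gcongr
      _ = _ := by ring
  -- Here `x = T ^ (k * u)`. Subtracting `1` leaves room for the upper ends of the windows: `T ^ (k
  -- * (B + 1)) ≤ x ≤ T ^ (k * (B + 2))`.
  set B := ⌊u⌋₊ - 1 with hB
  set F := B / (2 * (n + 1)) with hFdef
  have hLpos : 0 < L ^ (1 - η) := by positivity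
  have hu1 : 2 * k * (L ^ (1 - η) + 2) ≤ u := by
    refine le_trans ?_ hu0
    calc 2 * k * (L ^ (1 - η) + 2) ≤ 2 * k * (1 / (4 * k ^ 2) * (L / Real.log L ^ 2)) := by gcongr
      _ = _ := by field_simp; ring
  have hu2 : 1 ≤ u := by nlinarith
  have hufl : 1 ≤ ⌊u⌋₊ := Nat.le_floor (by simpa using hu2)
  have hB1 : B + 1 = ⌊u⌋₊ := by omega
  have hB2 : (B : ℝ) + 1 ≤ u := by
    have := Nat.floor_le (show 0 ≤ u by linarith)
    rw [← hB1] at this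
    exact_mod_cast this
  have hB3 : u < (B : ℝ) + 2 := by
    have := Nat.lt_floor_add_one u
    rw [← hB1] at this
    push_cast at this
    linarith
  have hlx : Real.log x = k * Real.log T * u := by rw [hu]; field_simp
  have hTX : (T : ℝ) ^ ((n + 1) * (B + 1)) ≤ x := by
    rw [← Real.log_le_log_iff (by positivity) hx0, Real.log_pow, hlx]
    push_cast
    calc (k * (B + 1)) * Real.log T = k * Real.log T * (B + 1) := by ring
      _ ≤ _ := by gcongr
  have hXT : x ≤ (T : ℝ) ^ ((n + 1) * (B + 2)) := by
    rw [← Real.log_le_log_iff hx0 (by positivity), Real.log_pow, hlx]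
    push_cast
    calc k * Real.log T * u ≤ k * Real.log T * (B + 2) := by gcongr
      _ = (k * (B + 2)) * Real.log T := by ring
  have hFB : 2 * (n * F) ≤ B := by
    have := Nat.div_mul_le_self B (2 * (n + 1))
    rw [← hFdef] at this
    nlinarith
  have hFL : L ^ (1 - η) ≤ F := by
    have h1 : B < (F + 1) * (2 * (n + 1)) := by
      rw [hFdef, mul_comm]
      exact Nat.lt_mul_div_succ _ (by positivity)
    have h2 : (B : ℝ) < (F + 1) * (2 * k) := by rw [hk]; exact_mod_cast h1
    have h3 : 2 * k * (L ^ (1 - η) + 2) ≤ 2 * k * (F + 2) := by nlinarith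
    have h4 := le_of_mul_le_mul_left h3 (by positivity)
    linarith
  have hcount : F ^ (n * n) * T ^ ((n + 1) * ((n + 1) * B)) ≤
      (equalProducts (n + 1) q ⌊x⌋₊).card := by
    refine le_trans (le_card_coprimeMatrices n B F T q ⌊x⌋₊ hTnat hq hFB
      (Nat.le_floor (by exact_mod_cast hTX)) ?_) (card_coprimeMatrices_le _ _ _)
    intro M hM hMX e he
    refine hwin T hT1 M hM ?_ e ?_
    · have hq0 : (0 : ℝ) < q := by exact_mod_cast hq
      have h1 : (M : ℝ) ≤ (q : ℝ) ^ (1 + (n + 1) * (n + 1)) := by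
        calc (M : ℝ) ≤ q * (⌊x⌋₊ : ℝ) ^ ((n + 1) * (n + 1)) := by exact_mod_cast hMX
          _ ≤ q * (q : ℝ) ^ ((n + 1) * (n + 1)) := by
            have := (Nat.floor_le hx0.le).trans hxq
            gcongr ?_ * ?_ ^ _
          _ = _ := by rw [pow_add, pow_one]
      have h2 := Real.log_le_log (by exact_mod_cast hM) h1
      rw [Real.log_pow, hqL] at h2
      push_cast at h2
      exact h2
    · rw [← Real.le_log_iff_exp_le (by positivity), Real.log_pow]
      have he' : (B : ℝ) ≤ 2 * e := by exact_mod_cast he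
      calc 1 / (2 * k) * (L / Real.log L) ≤ 1 / (2 * k) * Real.log x := by gcongr
        _ = u / 2 * Real.log T := by rw [hlx]; field_simp
        _ ≤ _ := by
          gcongr
          push_cast
          linarith
  -- Rounding `u` down to `B` costs `T ^ (2 * (n + 1) ^ 2)`, and `T ≤ 2 * L ^ η ≤ L ^ (2 * η)`.
  have hpow : x ^ (n + 1) ≤
      (T : ℝ) ^ ((n + 1) * ((n + 1) * B)) * L ^ (η * (4 * (n + 1) ^ 2 : ℕ)) := by
    have hTL : (T : ℝ) ^ 2 ≤ L ^ (η * (4 : ℕ)) := by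
      rw [Real.rpow_mul hL0.le, Real.rpow_natCast]
      have : (T : ℝ) ≤ (L ^ η) ^ 2 := by nlinarith
      calc (T : ℝ) ^ 2 ≤ ((L ^ η) ^ 2) ^ 2 := by gcongr
        _ = _ := by ring
    calc x ^ (n + 1) ≤ ((T : ℝ) ^ ((n + 1) * (B + 2))) ^ (n + 1) := by gcongr
      _ = (T : ℝ) ^ ((n + 1) * ((n + 1) * B)) * ((T : ℝ) ^ 2) ^ ((n + 1) ^ 2) := by
        rw [← pow_mul, ← pow_mul, ← pow_add]; congr 1; ring
      _ ≤ (T : ℝ) ^ ((n + 1) * ((n + 1) * B)) * (L ^ (η * (4 : ℕ))) ^ ((n + 1) ^ 2) := by gcongr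
      _ = _ := by
        rw [← Real.rpow_natCast (L ^ (η * (4 : ℕ))), ← Real.rpow_mul hL0.le]
        congr 2
        push_cast
        ring
  have hLF : L ^ ((1 - η) * (n * n : ℕ)) ≤ (F : ℝ) ^ (n * n) := by
    rw [Real.rpow_mul hL0.le, Real.rpow_natCast]
    gcongr
  calc x ^ (n + 1) * L ^ ((1 - η) * (n * n : ℕ) - η * (4 * (n + 1) ^ 2 : ℕ))
      ≤ (T : ℝ) ^ ((n + 1) * ((n + 1) * B)) * L ^ (η * (4 * (n + 1) ^ 2 : ℕ)) *
        L ^ ((1 - η) * (n * n : ℕ) - η * (4 * (n + 1) ^ 2 : ℕ)) := by gcongr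
    _ = L ^ ((1 - η) * (n * n : ℕ)) * (T : ℝ) ^ ((n + 1) * ((n + 1) * B)) := by
      rw [mul_assoc, ← Real.rpow_add hL0, mul_comm]
      congr 2
      ring
    _ ≤ (F : ℝ) ^ (n * n) * (T : ℝ) ^ ((n + 1) * ((n + 1) * B)) := by gcongr
    _ ≤ _ := by exact_mod_cast hcount

/-! ### Large character sums and the choice of `δ` -/

/-- Every character sum mod `q` in the given range of lengths `x` exceeds the square root of its
length by the factor `(log q) ^ ((k - 1) ^ 2 / (2 * k) - ε)` for some non-principal character. -/
def HasLargeCharacterSums (k q : ℕ) (ε : ℝ) : Prop :=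
  ∀ x : ℝ, Real.exp (Real.log (q : ℝ) / Real.log (Real.log (q : ℝ))) ≤ x →
    x < (q : ℝ) ^ ((1 : ℝ) / (k : ℝ)) →
    ∃ χ : DirichletCharacter ℂ q, χ ≠ 1 ∧
      (Real.log (q : ℝ)) ^ (((k : ℝ) - 1) ^ 2 / (2 * (k : ℝ)) - ε) ≤
        (1 / Real.sqrt x) * ‖∑ n ∈ Finset.Icc 1 ⌊x⌋₊, χ (n : ZMod q)‖

theorem pow_lt_of_lt_rpow_one_div {k q : ℕ} (hk : k ≠ 0) {x : ℝ} (hx0 : 0 ≤ x)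
    (hx : x < (q : ℝ) ^ ((1 : ℝ) / (k : ℝ))) : x ^ k < q := by
  calc x ^ k < ((q : ℝ) ^ ((1 : ℝ) / (k : ℝ))) ^ k := pow_lt_pow_left₀ hx hx0 hk
    _ = q := by rw [one_div, Real.rpow_inv_natCast_pow (Nat.cast_nonneg q) hk]

theorem eventually_hasLargeCharacterSums (k : ℕ) (hk : 2 ≤ k) (ε : ℝ) (hε : 0 < ε) :
    ∀ᶠ q : ℕ in atTop, HasLargeCharacterSums k q ε := by
  obtain ⟨n, rfl⟩ : ∃ n, k = n + 1 := ⟨k - 1, by omega⟩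
  have hn : (1 : ℝ) ≤ n := by exact_mod_cast (by omega : 1 ≤ n)
  set k : ℝ := (n : ℝ) + 1 with hkdef
  have hk2 : 2 ≤ k := by linarith
  -- The first bound makes the total loss `5 * k ^ 2 * η + η` at most `2 * k * ε`; the second gives
  -- `s ≥ 2 * η`, so that the principal character is absorbed.
  set η := min (ε / (3 * k)) (1 / (7 * k ^ 2)) with hη
  have hη0 : 0 < η := lt_min (by positivity) (by positivity)
  have hηε : 3 * k * η ≤ ε := by
    have := min_le_left (ε / (3 * k)) (1 / (7 * k ^ 2))
    rwa [← hη, le_div_iff₀ (by positivity), mul_comm] at this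
  have hηk : 7 * k ^ 2 * η ≤ 1 := by
    have := min_le_right (ε / (3 * k)) (1 / (7 * k ^ 2))
    rwa [← hη, le_div_iff₀ (by positivity), mul_comm] at this
  have hk4 : 4 ≤ k ^ 2 := by nlinarith
  have hη1 : η ≤ 1 := by nlinarith
  have hlog : Tendsto (fun q : ℕ => Real.log q) atTop atTop :=
    Real.tendsto_log_atTop.comp tendsto_natCast_atTop_atTop
  filter_upwards [hlog.eventually (eventually_le_card_equalProducts n η hη0 hη1),
    hlog.eventually (eventually_le_totient η hη0),
    hlog.eventually ((tendsto_rpow_atTop (y := η) hη0).eventually_ge_atTop 2),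
    hlog.eventually (Real.tendsto_log_atTop.eventually_ge_atTop 1),
    hlog.eventually_ge_atTop 1, eventually_ge_atTop 1] with q hN hφ hLη hlogL hL1 hq x hx hxq
  have : NeZero q := ⟨by omega⟩
  set L := Real.log (q : ℝ)
  have hL0 : 0 < L := by linarith
  have hx1 : 1 ≤ x := (Real.one_le_exp (by positivity)).trans hx
  have hx0 : 0 < x := by linarith
  have hxk : x ^ (n + 1) < q := pow_lt_of_lt_rpow_one_div (by omega) hx0.le hxq
  have hxleq : x ≤ q := (le_self_pow₀ hx1 (by omega)).trans hxk.le
  have hN' := hN q hq rfl x hx hxleq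
  have hφ' := hφ q hq rfl
  set s := (1 - η) * (n * n : ℕ) - η * (4 * (n + 1) ^ 2 : ℕ) with hs
  have hs1 : (n : ℝ) ^ 2 - 5 * k ^ 2 * η ≤ s := by
    have h1 : (n : ℝ) ^ 2 ≤ k ^ 2 := by gcongr; linarith
    have h2 : s = (n : ℝ) ^ 2 - η * n ^ 2 - 4 * k ^ 2 * η := by
      rw [hs, hkdef]; push_cast; ring
    rw [h2]
    nlinarith
  have hs2 : 2 * η ≤ s := by nlinarith
  have hqφ : (q : ℝ) ≤ q.totient * L ^ η := by
    rw [Real.rpow_neg hL0.le, ← div_eq_mul_inv, div_le_iff₀ (by positivity)] at hφ'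
    exact hφ'
  set A := x ^ (n + 1) * L ^ (s - η) with hA
  have hLs : L ^ η + L ^ (s - η) ≤ L ^ s := by
    have h1 : L ^ η ≤ L ^ (s - η) := Real.rpow_le_rpow_of_exponent_le hL1 (by linarith)
    have h2 : L ^ s = L ^ η * L ^ (s - η) := by
      rw [← Real.rpow_add hL0]; congr 1; ring
    have h3 : 0 < L ^ (s - η) := by positivity
    nlinarith
  obtain ⟨χ, hχ, hχA⟩ := exists_character_le_norm_pow (q := q) (n + 1) ⌊x⌋₊ (A := A)
    (by positivity) (by
      have hc : (((Finset.Icc 1 ⌊x⌋₊).filter fun a => a.Coprime q).card : ℝ) ≤ x := by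
        refine le_trans ?_ (Nat.floor_le hx0.le)
        have := Finset.card_filter_le (Finset.Icc 1 ⌊x⌋₊) fun a => a.Coprime q
        rw [Nat.card_Icc, Nat.add_sub_cancel] at this
        exact_mod_cast this
      calc _ ≤ x ^ (2 * (n + 1)) + q.totient * A := by gcongr
        _ = x ^ (n + 1) * x ^ (n + 1) + q.totient * A := by ring
        _ ≤ x ^ (n + 1) * (q.totient * L ^ η) + q.totient * A := by
          gcongr
          exact hxk.le.trans hqφ
        _ = q.totient * (x ^ (n + 1) * (L ^ η + L ^ (s - η))) := by rw [hA]; ring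
        _ ≤ q.totient * (x ^ (n + 1) * L ^ s) := by gcongr
        _ ≤ _ := by gcongr)
  refine ⟨χ, hχ, ?_⟩
  have hsx : 0 < √x := Real.sqrt_pos.2 hx0
  rw [one_div, le_inv_mul_iff₀ hsx]
  refine le_of_pow_le_pow_left₀ (n := 2 * (n + 1)) (by omega) (norm_nonneg _) (le_trans ?_ hχA)
  rw [mul_pow, pow_mul √x, Real.sq_sqrt hx0.le, hA]
  gcongr
  rw [← Real.rpow_natCast, ← Real.rpow_mul hL0.le]
  refine Real.rpow_le_rpow_of_exponent_le hL1 ?_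
  have : (((n + 1 : ℕ) : ℝ) - 1) ^ 2 / (2 * ((n + 1 : ℕ) : ℝ)) - ε = (n : ℝ) ^ 2 / (2 * k) - ε := by
    rw [hkdef]; push_cast; ring
  rw [this]
  have h2 : ((n : ℝ) ^ 2 / (2 * k) - ε) * ((2 * (n + 1) : ℕ) : ℝ) = n ^ 2 - 2 * k * ε := by
    have : ((2 * (n + 1) : ℕ) : ℝ) = 2 * k := by rw [hkdef]; push_cast; ring
    rw [this]; field_simp
  rw [h2]
  have h3 : 2 * k * (3 * k * η) ≤ 2 * k * ε := by gcongr
  nlinarith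

theorem one_lt_log_natCast {q : ℕ} (hq : 3 ≤ q) : 1 < Real.log q := by
  have h3 : (3 : ℝ) ≤ q := by exact_mod_cast hq
  rw [Real.lt_log_iff_exp_lt (by linarith)]
  exact Real.exp_one_lt_three.trans_le h3

theorem HasLargeCharacterSums.mono {k q : ℕ} (hq : 3 ≤ q) {ε ε' : ℝ} (h : ε ≤ ε')
    (hP : HasLargeCharacterSums k q ε) : HasLargeCharacterSums k q ε' := by
  intro x hx hxq
  obtain ⟨χ, hχ, hle⟩ := hP x hx hxq
  exact ⟨χ, hχ, le_trans (Real.rpow_le_rpow_of_exponent_le (one_lt_log_natCast hq).le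
    (by linarith)) hle⟩

theorem exists_hasLargeCharacterSums (k : ℕ) (hk : 2 ≤ k) {q : ℕ} (hq : 3 ≤ q) :
    ∃ ε : ℝ, 0 ≤ ε ∧ HasLargeCharacterSums k q ε := by
  have hL := one_lt_log_natCast hq
  have hq0 : (0 : ℝ) < q := by exact_mod_cast (by omega : 0 < q)
  set L := Real.log (q : ℝ) with hLdef
  have hL0 : 0 < L := by linarith
  have hlogL : 0 < Real.log L := Real.log_pos hL
  -- Chosen so that the target becomes `L ^ (-(L / log L)) = 1 / q`.
  refine ⟨((k : ℝ) - 1) ^ 2 / (2 * (k : ℝ)) + L / Real.log L, by positivity, ?_⟩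
  intro x hx hxq
  have hx1 : 1 ≤ x := (Real.one_le_exp (by positivity)).trans hx
  have hx0 : 0 < x := by linarith
  have hxk : x ^ k < q := pow_lt_of_lt_rpow_one_div (by omega) hx0.le hxq
  have hx2 : x ^ 2 < q := (pow_le_pow_right₀ hx1 hk).trans_lt hxk
  have hX1 : 1 ≤ ⌊x⌋₊ := Nat.le_floor (by simpa using hx1)
  have hX2 : ⌊x⌋₊ ^ 2 < q := by
    have : (⌊x⌋₊ : ℝ) ^ 2 < q := lt_of_le_of_lt (by gcongr; exact Nat.floor_le hx0.le) hx2
    exact_mod_cast this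
  have hX : ⌊x⌋₊ + 1 < q := by
    rcases Nat.lt_or_ge ⌊x⌋₊ 2 with h | h
    · omega
    · nlinarith
  obtain ⟨χ, hχ, hle⟩ := exists_character_inv_le_norm_sq (by omega) hX1 hX
  refine ⟨χ, hχ, ?_⟩
  have hexp : L ^ (((k : ℝ) - 1) ^ 2 / (2 * (k : ℝ)) -
      (((k : ℝ) - 1) ^ 2 / (2 * (k : ℝ)) + L / Real.log L)) = 1 / q := by
    rw [Real.rpow_def_of_pos hL0, sub_add_cancel_left, mul_neg, mul_div_cancel₀ _ hlogL.ne',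
      Real.exp_neg, hLdef, Real.exp_log hq0, one_div]
  rw [hexp]
  have hsq : 1 / √(q : ℝ) ≤ ‖∑ n ∈ Finset.Icc 1 ⌊x⌋₊, χ (n : ZMod q)‖ := by
    rw [← Real.sqrt_one, ← Real.sqrt_div zero_le_one]
    exact (Real.sqrt_le_left (norm_nonneg _)).2 hle
  have hxq' : x ≤ q := by nlinarith
  have hsx : 0 < √x := Real.sqrt_pos.2 hx0
  calc 1 / (q : ℝ) = 1 / √(q : ℝ) * (1 / √(q : ℝ)) := by
        rw [div_mul_div_comm, Real.mul_self_sqrt hq0.le, one_mul]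
    _ ≤ _ := by gcongr

theorem theorem7 (k : ℕ) (hk : 2 ≤ k) :
    ∃ C : ℝ, 0 < C ∧ ∃ δ : ℕ → ℝ, Tendsto δ atTop (𝓝 0) ∧
      ∀ q : ℕ, 3 ≤ q → ∀ x : ℝ,
        Real.exp (Real.log (q : ℝ) / Real.log (Real.log (q : ℝ))) ≤ x →
        x < (q : ℝ) ^ ((1 : ℝ) / (k : ℝ)) →
        ∃ χ : DirichletCharacter ℂ q, χ ≠ 1 ∧
          C * (Real.log (q : ℝ)) ^ (((k : ℝ) - 1) ^ 2 / (2 * (k : ℝ)) + δ q) ≤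
            (1 / Real.sqrt x) * ‖∑ n ∈ Finset.Icc 1 ⌊x⌋₊, χ (n : ZMod q)‖ := by
  let A : ℕ → Set ℝ := fun q => {ε | 0 ≤ ε ∧ HasLargeCharacterSums k q ε}
  have hbdd : ∀ q, BddBelow (A q) := fun q => ⟨0, fun _ h => h.1⟩
  have hinf : Tendsto (fun q => sInf (A q)) atTop (𝓝 0) := by
    refine Metric.tendsto_atTop'.2 fun ε hε => ?_
    obtain ⟨N, hN⟩ := eventually_atTop.1
      (eventually_hasLargeCharacterSums k hk (ε / 2) (by positivity))
    refine ⟨N, fun q hq => ?_⟩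
    have h1 : sInf (A q) ≤ ε / 2 := csInf_le (hbdd q) ⟨by positivity, hN q hq.le⟩
    have h0 : 0 ≤ sInf (A q) := Real.sInf_nonneg fun _ h => h.1
    rw [Real.dist_eq, sub_zero, abs_of_nonneg h0]
    linarith
  -- The infimum need not be attained; the vanishing term `1 / (q + 1)` leaves room for an
  -- admissible loss below it.
  refine ⟨1, one_pos, fun q => -(sInf (A q) + 1 / ((q : ℝ) + 1)), ?_, ?_⟩
  · simpa using (hinf.add tendsto_one_div_add_atTop_nhds_zero_nat).neg
  · intro q hq
    have hlt : sInf (A q) < sInf (A q) + 1 / ((q : ℝ) + 1) := by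
      have : (0 : ℝ) < 1 / ((q : ℝ) + 1) := by positivity
      linarith
    obtain ⟨ε, hε, hεlt⟩ := exists_lt_of_csInf_lt (exists_hasLargeCharacterSums k hk hq) hlt
    intro x hx hxq
    obtain ⟨χ, hχ, hle⟩ := hε.2.mono hq hεlt.le x hx hxq
    exact ⟨χ, hχ, by simpa only [one_mul, ← sub_eq_add_neg] using hle⟩
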